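/- Let $G$ be the $m\times n$ grid graph, i.e. the graph on the integer points $(i,j)$, $0\le i<m$, $0\le j<n$, in which points at distance $1$ are adjacent. A *box* of $G$ is a unit square face of $G$; two distinct boxes are *adjacent* if they share an edge. For a graph $K$ consisting of edges of $G$, adjacent boxes are *$K$-neighbours* if they share no edge of $K$; a *$K$-path* is a sequence of distinct boxes of $G$ in which consecutive boxes are $K$-neighbours; a *$K$-cycle* is a sequence $X_1,\dots,X_r=X_1$ ($r\ge 4$) of boxes of $G$ with consecutive boxes $K$-neighbours and $X_1,\dots,X_{r-1}$ distinct. A box is *switchable* in $K$ if exactly two of its edges belong to $K$ and these two are parallel; *switching* it removes these two edges from $K$ and adds the other two. For a Hamiltonian cycle $H$ of $G$ and boxes $Z,W$, the double-switch move $Z\mapsto W$ is *valid* if $Z$ is switchable in $H$, $W$ is switchable in the graph obtained by switching $Z$, and switching $W$ then yields a Hamiltonian cycle of $G$. **Proposition.** Let $H$ be a Hamiltonian cycle of $G$, let $W$ be a switchable box in $H$ such that there are two distinct boxes $X,Y$ of $G$ which are adjacent to $W$ but not $H$-neighbours of $W$, and let $P(X,Y)$ be an $H$-path of boxes of $G$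 from $X$ to $Y$ (the looping $H$-path of $W$). 1. If $Z$ is a box of $P(X,Y)$, other than the end-boxes $X$ and $Y$, which is switchable in $H$, then $Z\mapsto W$ is a valid double-switch move. 2. Let $H'$ be the graph obtained from $H$ by switching $W$. Then $H'$ consists of two vertex-disjoint cycles $H_1$ and $H_2$; the sequence $P(X,Y),W,X$ is an $H'$-cycle of boxes; and a box of $G$ belongs to this $H'$-cycle if and only if it is incident on a vertex of $H_1$ and on a vertex of $H_2$. -/

import Mathlib

/-- The `m × n` grid graph: vertices are the integer points `(i, j)` with `0 ≤ i < m`, `0 ≤ j < n`,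
and two vertices are adjacent when they are at distance one. -/
def gridGraph (m n : ℕ) : SimpleGraph (Fin m × Fin n) :=
  SimpleGraph.boxProd (SimpleGraph.pathGraph m) (SimpleGraph.pathGraph n)

/-- A box of the `m × n` grid graph, i.e. the unit square face `[k, k+1] × [l, l+1]`, recorded by
its corner `(k, l)` closest to the origin. -/
@[ext]
structure GridBox (m n : ℕ) where
  k : ℕ
  l : ℕ
  hk : k + 1 < m
  hl : l + 1 < n

namespace GridBox

variable {m n : ℕ}

/-- The corner `(k, l)`. -/
def sw (B : GridBox m n) : Fin m × Fin n :=
  (⟨B.k, Nat.lt_of_succ_lt B.hk⟩, ⟨B.l, Nat.lt_of_succ_lt B.hl⟩)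

/-- The corner `(k + 1, l)`. -/
def se (B : GridBox m n) : Fin m × Fin n :=
  (⟨B.k + 1, B.hk⟩, ⟨B.l, Nat.lt_of_succ_lt B.hl⟩)

/-- The corner `(k, l + 1)`. -/
def nw (B : GridBox m n) : Fin m × Fin n :=
  (⟨B.k, Nat.lt_of_succ_lt B.hk⟩, ⟨B.l + 1, B.hl⟩)

/-- The corner `(k + 1, l + 1)`. -/
def ne (B : GridBox m n) : Fin m × Fin n :=
  (⟨B.k + 1, B.hk⟩, ⟨B.l + 1, B.hl⟩)

/-- The four vertices of a box. -/
def verts (B : GridBox m n) : Set (Fin m × Fin n) := {B.sw, B.se, B.ne, B.nw}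

/-- The four sides of a box. The sides `south` and `north` are parallel, and so are `east` and
`west`. -/
def south (B : GridBox m n) : Sym2 (Fin m × Fin n) := s(B.sw, B.se)

/-- See `south`. -/
def east (B : GridBox m n) : Sym2 (Fin m × Fin n) := s(B.se, B.ne)

/-- See `south`. -/
def north (B : GridBox m n) : Sym2 (Fin m × Fin n) := s(B.nw, B.ne)

/-- See `south`. -/
def west (B : GridBox m n) : Sym2 (Fin m × Fin n) := s(B.sw, B.nw)

/-- The set of the four edges of a box. -/
def edges (B : GridBox m n) : Set (Sym2 (Fin m × Fin n)) := {B.south, B.east, B.north, B.west}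

/-- Two distinct boxes are adjacent if they share an edge. -/
def Adjacent (B C : GridBox m n) : Prop := B ≠ C ∧ (B.edges ∩ C.edges).Nonempty

end GridBox

/-- `H`, a graph on the vertices of the `m × n` grid graph `G`, is a Hamiltonian cycle of `G`:
it is a subgraph of `G` which is traversed, with all its edges, by a Hamiltonian closed walk. -/
def IsHamCycleOfGrid {m n : ℕ} (H : SimpleGraph (Fin m × Fin n)) : Prop :=
  H ≤ gridGraph m n ∧
    ∃ (v : Fin m × Fin n) (p : H.Walk v v), p.IsHamiltonianCycle ∧ p.toSubgraph = ⊤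

/-- Adjacent boxes are `H`-neighbours if they share no edge of `H`. -/
def IsHNeighbour {m n : ℕ} (H : SimpleGraph (Fin m × Fin n)) (B C : GridBox m n) : Prop :=
  B.Adjacent C ∧ B.edges ∩ C.edges ∩ H.edgeSet = ∅

/-- The graph on the boxes of `G` given by `H`-adjacency. Its paths are the `H`-paths of boxes
in `G`. -/
def hBoxGraph {m n : ℕ} (H : SimpleGraph (Fin m × Fin n)) : SimpleGraph (GridBox m n) where
  Adj B C := IsHNeighbour H B C
  symm := ⟨fun B C h => by
    refine ⟨⟨h.1.1.symm, ?_⟩, ?_⟩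
    · rw [Set.inter_comm]; exact h.1.2
    · rw [Set.inter_comm C.edges]; exact h.2⟩
  loopless := ⟨fun _ h => h.1.1 rfl⟩

/-- An `H`-cycle of boxes: a sequence `X₁, …, X_r = X₁` with `r ≥ 4`, consecutive members
`H`-neighbours, and `X₁, …, X_{r-1}` distinct. -/
def IsHBoxCycle {m n : ℕ} (H : SimpleGraph (Fin m × Fin n)) (L : List (GridBox m n)) : Prop :=
  4 ≤ L.length ∧ L.head? = L.getLast? ∧ L.IsChain (IsHNeighbour H) ∧ L.dropLast.Nodup

/-- A box is switchable in `H` if exactly two of its edges are in `H` and these are parallel. -/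
def IsSwitchable {m n : ℕ} (H : SimpleGraph (Fin m × Fin n)) (B : GridBox m n) : Prop :=
  (B.south ∈ H.edgeSet ∧ B.north ∈ H.edgeSet ∧ B.east ∉ H.edgeSet ∧ B.west ∉ H.edgeSet) ∨
  (B.east ∈ H.edgeSet ∧ B.west ∈ H.edgeSet ∧ B.south ∉ H.edgeSet ∧ B.north ∉ H.edgeSet)

/-- The switch move on a box `B` (used for a switchable `B`): the edges of `B` which are in `H` are
removed, and the edges of `B` which are not in `H` are added. -/
def switchMove {m n : ℕ} (H : SimpleGraph (Fin m × Fin n)) (B : GridBox m n) :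
    SimpleGraph (Fin m × Fin n) :=
  SimpleGraph.fromEdgeSet ((H.edgeSet \ B.edges) ∪ (B.edges \ H.edgeSet))

/-- `Z ↦ W` is a valid double-switch move in `H`: `Z` is switchable in `H`, after switching `Z` the
box `W` is switchable, and switching `W` then yields a Hamiltonian cycle. -/
def IsValidMove {m n : ℕ} (H : SimpleGraph (Fin m × Fin n)) (Z W : GridBox m n) : Prop :=
  IsSwitchable H Z ∧ IsSwitchable (switchMove H Z) W ∧
    IsHamCycleOfGrid (switchMove (switchMove H Z) W)

/-- `P` is the looping `H`-path of `W`: its end-boxes `X`, `Y` are the two boxes adjacent to `W`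
that are not `H`-neighbours of `W`, and `P` is an `H`-path of boxes of `G` between them. -/
def IsLoopingPath {m n : ℕ} (H : SimpleGraph (Fin m × Fin n)) (W : GridBox m n)
    {X Y : GridBox m n} (P : (hBoxGraph H).Walk X Y) : Prop :=
  X ≠ Y ∧ (W.Adjacent X ∧ ¬ IsHNeighbour H W X) ∧ (W.Adjacent Y ∧ ¬ IsHNeighbour H W Y) ∧ P.IsPath

/-- The subgraph `C` of `K` is a cycle. -/
def IsCycleSubgraph {V : Type*} {K : SimpleGraph V} (C : K.Subgraph) : Prop :=
  ∃ (v : V) (c : K.Walk v v), c.IsCycle ∧ c.toSubgraph = C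

/-- The graph `K` consists of the two vertex-disjoint cycles `H₁` and `H₂`. -/
def ConsistsOfTwoCycles {V : Type*} (K : SimpleGraph V) (H₁ H₂ : K.Subgraph) : Prop :=
  IsCycleSubgraph H₁ ∧ IsCycleSubgraph H₂ ∧ Disjoint H₁.verts H₂.verts ∧ H₁ ⊔ H₂ = ⊤

/-!
The proof works modulo 2. A closed path of boxes `Q` leaves every box through an even number of its
sides, so the set of grid edges crossed by `Q` is a mod 2 cocycle, hence the coboundary of a
function `f` on the vertices (`exists_potential`). If consecutive boxes of `Q` are `K`-neighbours,
`f` is constant along the edges of `K`, while the boxes on which `f` is not constant are exactly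
the boxes of `Q` (`exists_two_sides`). This is the only planarity argument needed.

Applied to a Hamiltonian cycle `H` with one edge `e` removed, it shows that the two boxes along `e`
are not joined by an `H`-path, since `e` is not a bridge (`IsHamCycleOfGrid.not_reachable`). Hence
the looping path `P` of `W` does not contain `W`, its interior boxes share no side with `W`
(`IsLoopingPath.disjoint_edges`), and `P, W, X` is an `H'`-cycle, where `H'` is `H` with `W`
switched. The function `f` attached to this cycle is nonconstant on `W` and invariant under `H'`,
which is two-regular and has at most two components; so the components of `H'` are the two level
sets of `f` (`IsQuadExchange.reachable_iff`), and the boxes touching both are those of the cycle.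
Switching an interior box `Z` of `P` exchanges an edge of each component for two edges joining
them, which gives a connected two-regular graph (`IsQuadExchange.preconnected`). Finally, the
switches of `Z` and `W` commute.
-/

/-! ### Two-regular graphs and edge exchanges -/

section GraphLemmas

variable {V : Type*} {G G' : SimpleGraph V} {a b c d : V}

/-- Every vertex of `G` has exactly two neighbours. -/
def IsTwoRegular (G : SimpleGraph V) : Prop := ∀ v, (G.neighborSet v).ncard = 2

theorem IsTwoRegular.isCycles (h : IsTwoRegular G) : G.IsCycles := fun v _ => h v

theorem IsTwoRegular.adj_toSubgraph [Finite V] (h : IsTwoRegular G) {u : V} {p : G.Walk u u}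
    (hp : p.IsCycle) {v w : V} (hv : v ∈ p.toSubgraph.verts) (hvw : G.Adj v w) :
    p.toSubgraph.Adj v w := by
  classical
  have := Fintype.ofFinite V
  exact (hp.adj_toSubgraph_iff_of_isCycles h.isCycles hv w).2 hvw

theorem IsTwoRegular.exists_isCycle [Finite V] (h : IsTwoRegular G) (v : V) :
    ∃ p : G.Walk v v, p.IsCycle ∧ p.toSubgraph.verts = {w | G.Reachable w v} := by
  obtain ⟨p, hp, hs⟩ := h.isCycles.exists_cycle_toSubgraph_verts_eq_connectedComponentSupp
    (c := G.connectedComponentMk v) (v := v) rfl (Set.nonempty_of_ncard_ne_zero (by rw [h v]; simp))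
  refine ⟨p, hp, hs.trans ?_⟩
  ext w
  simp [SimpleGraph.ConnectedComponent.mem_supp_iff, SimpleGraph.ConnectedComponent.eq]

theorem eq_of_reachable {α : Type*} {f : V → α} (hf : ∀ u v, G.Adj u v → f u = f v) {u v : V}
    (h : G.Reachable u v) : f u = f v := by
  obtain ⟨p⟩ := h
  induction p with
  | nil => rfl
  | cons h _ ih => exact (hf _ _ h).trans ih

theorem reachable_of_forall_adj (hG : ∀ u v, G.Adj u v → G'.Reachable u v) {u v : V}
    (h : G.Reachable u v) : G'.Reachable u v := by
  obtain ⟨p⟩ := h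
  induction p with
  | nil => rfl
  | cons h _ ih => exact (hG _ _ h).trans ih

/-- No edge of a two-regular graph is a bridge. -/
theorem IsTwoRegular.reachable_deleteEdges [Finite V] (h : IsTwoRegular G) {u v : V}
    (huv : G.Reachable u v) (hab : G.Adj a b) : (G.deleteEdges {s(a, b)}).Reachable u v := by
  refine reachable_of_forall_adj (fun x y hxy => ?_) huv
  have hr := h.isCycles.reachable_deleteEdges hab
  by_cases he : s(x, y) = s(a, b)
  · rcases Sym2.eq_iff.1 he with ⟨rfl, rfl⟩ | ⟨rfl, rfl⟩
    exacts [hr, hr.symm]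
  · exact SimpleGraph.Adj.reachable (by simp [SimpleGraph.deleteEdges_adj, hxy, he])

/-- Deleting the edge `cd` splits the component of `c` into at most two parts. -/
theorem reachable_deleteEdges_or {u : V} (h : G.Reachable u c) (d : V) :
    (G.deleteEdges {s(c, d)}).Reachable u c ∨ (G.deleteEdges {s(c, d)}).Reachable u d := by
  obtain ⟨p⟩ := h
  induction p with
  | nil => exact .inl .rfl
  | @cons u v c huv _ ih =>
    by_cases he : s(u, v) = s(c, d)
    · rcases Sym2.eq_iff.1 he with ⟨rfl, rfl⟩ | ⟨rfl, rfl⟩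
      exacts [.inl .rfl, .inr .rfl]
    · have : (G.deleteEdges {s(c, d)}).Adj u v := by simp [SimpleGraph.deleteEdges_adj, huv, he]
      exact ih.imp this.reachable.trans this.reachable.trans

/-- A path on which the invariant `f` differs from its value at `a` does not use the edge `ab`. -/
theorem reachable_deleteEdges_of_ne {α : Type*} {f : V → α} (hf : ∀ u v, G.Adj u v → f u = f v)
    {u v : V} (h : G.Reachable u v) (hu : f u ≠ f a) (hab : f a = f b) :
    (G.deleteEdges {s(a, b)}).Reachable u v := by
  obtain ⟨p⟩ := h
  induction p with
  | nil => rfl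
  | @cons u v w huv _ ih =>
    have : (G.deleteEdges {s(a, b)}).Adj u v := by
      simp only [SimpleGraph.deleteEdges_adj, huv, Set.mem_singleton_iff, true_and]
      intro he
      rcases Sym2.eq_iff.1 he with ⟨rfl, rfl⟩ | ⟨rfl, rfl⟩
      exacts [hu rfl, hu hab.symm]
    exact this.reachable.trans (ih (hf _ _ huv ▸ hu))

/-- `G'` is obtained from `G` by exchanging the opposite sides `ab` and `cd` of the quadrilateral
`abcd` for the two other sides `bc` and `ad`. -/
structure IsQuadExchange (G G' : SimpleGraph V) (a b c d : V) : Prop where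
  ne_ac : a ≠ c
  ne_bd : b ≠ d
  ne_bc : b ≠ c
  ne_ad : a ≠ d
  ab : G.Adj a b
  cd : G.Adj c d
  not_bc : ¬ G.Adj b c
  not_ad : ¬ G.Adj a d
  adj_iff : ∀ u v, G'.Adj u v ↔
    (G.Adj u v ∧ s(u, v) ≠ s(a, b) ∧ s(u, v) ≠ s(c, d)) ∨ s(u, v) = s(b, c) ∨ s(u, v) = s(a, d)

namespace IsQuadExchange

theorem swap_pairs (h : IsQuadExchange G G' a b c d) : IsQuadExchange G G' c d a b where
  ne_ac := h.ne_ac.symm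
  ne_bd := h.ne_bd.symm
  ne_bc := h.ne_ad.symm
  ne_ad := h.ne_bc.symm
  ab := h.cd
  cd := h.ab
  not_bc := fun H => h.not_ad H.symm
  not_ad := fun H => h.not_bc H.symm
  adj_iff u v := by
    rw [h.adj_iff, Sym2.eq_swap (a := d), Sym2.eq_swap (a := c) (b := b)]; tauto

theorem flip (h : IsQuadExchange G G' a b c d) : IsQuadExchange G G' b a d c where
  ne_ac := h.ne_bd
  ne_bd := h.ne_ac
  ne_bc := h.ne_ad
  ne_ad := h.ne_bc
  ab := h.ab.symm
  cd := h.cd.symm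
  not_bc := h.not_ad
  not_ad := h.not_bc
  adj_iff u v := by
    rw [h.adj_iff, Sym2.eq_swap (a := b) (b := a), Sym2.eq_swap (a := d) (b := c)]; tauto

theorem adj_bc (h : IsQuadExchange G G' a b c d) : G'.Adj b c := by simp [h.adj_iff]

theorem adj_ad (h : IsQuadExchange G G' a b c d) : G'.Adj a d := by simp [h.adj_iff]

theorem ncard_neighborSet (h : IsQuadExchange G G' a b c d) :
    (G'.neighborSet a).ncard = (G.neighborSet a).ncard := by
  have : G'.neighborSet a = insert d (G.neighborSet a \ {b}) := by
    ext v
    have h1 := h.ne_ac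
    have h2 := h.ne_ad
    have h3 := h.ab.ne
    simp only [SimpleGraph.mem_neighborSet, h.adj_iff, Set.mem_insert_iff, Set.mem_sdiff,
      Set.mem_singleton_iff, Sym2.eq_iff, ne_eq]
    grind
  rw [this]
  exact Set.ncard_exchange h.not_ad h.ab

theorem isTwoRegular (h : IsQuadExchange G G' a b c d) (hG : IsTwoRegular G) :
    IsTwoRegular G' := by
  intro v
  rw [← hG v]
  by_cases ha : v = a
  · exact ha ▸ h.ncard_neighborSet
  by_cases hb : v = b
  · exact hb ▸ h.flip.ncard_neighborSet
  by_cases hc : v = c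
  · exact hc ▸ h.swap_pairs.ncard_neighborSet
  by_cases hd : v = d
  · exact hd ▸ h.swap_pairs.flip.ncard_neighborSet
  congr 1
  ext w
  simp only [SimpleGraph.mem_neighborSet, h.adj_iff, Sym2.eq_iff, ne_eq]
  grind

theorem deleteEdges_le (h : IsQuadExchange G G' a b c d) :
    (G.deleteEdges {s(a, b)}).deleteEdges {s(c, d)} ≤ G' := by
  intro u v huv
  simp only [SimpleGraph.deleteEdges_adj, Set.mem_singleton_iff] at huv
  exact (h.adj_iff u v).2 (.inl ⟨huv.1.1, huv.1.2, huv.2⟩)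

/-- If an exchange in a Hamiltonian cycle leaves `a` and `b` separated by an invariant `f`, then the
new graph has exactly two components, the level sets of `f`. -/
theorem reachable_iff [Finite V] (h : IsQuadExchange G G' a b c d) (hG : IsTwoRegular G)
    (hc : G.Preconnected) {f : V → ZMod 2} (hf : ∀ u v, G'.Adj u v → f u = f v)
    (hab : f a ≠ f b) {u v : V} : G'.Reachable u v ↔ f u = f v := by
  refine ⟨eq_of_reachable hf, fun huv => ?_⟩
  have hbc := hf _ _ h.adj_bc
  have had := hf _ _ h.adj_ad
  -- `G` minus `ab` is connected, so the further deletion of `cd` leaves at most two components.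
  have key (w : V) : G'.Reachable w c ∨ G'.Reachable w d :=
    (reachable_deleteEdges_or (hG.reachable_deleteEdges (hc w c) h.ab) d).imp
      (.mono h.deleteEdges_le) (.mono h.deleteEdges_le)
  rcases key u with hu | hu <;> rcases key v with hv | hv
  · exact hu.trans hv.symm
  · exact absurd (by rw [had, hbc, ← eq_of_reachable hf hu, ← eq_of_reachable hf hv, huv]) hab
  · exact absurd (by rw [had, hbc, ← eq_of_reachable hf hu, ← eq_of_reachable hf hv, huv]) hab
  · exact hu.trans hv.symm

/-- If `ab` and `cd` lie on the two different components, the exchange joins these components. -/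
theorem preconnected [Finite V] (h : IsQuadExchange G G' a b c d) (hG : IsTwoRegular G)
    {f : V → ZMod 2} (hr : ∀ u v, G.Reachable u v ↔ f u = f v) (hac : f a ≠ f c) :
    G'.Preconnected := by
  have hf' : ∀ u v, G.Adj u v → f u = f v := fun u v huv => (hr u v).1 huv.reachable
  have hcd := hf' _ _ h.cd
  -- The edge `ab` is not a bridge, and neither is `cd` after the deletion of `ab`, since a path
  -- joining `c` to `d` stays in their own component.
  have hM : ∀ u v, G.Reachable u v → G'.Reachable u v := fun u v huv => by
    refine reachable_of_forall_adj (fun x y hxy => ?_) huv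
    by_cases h2 : s(x, y) = s(a, b) ∨ s(x, y) = s(c, d)
    · have hab' : G'.Reachable a b := by
        have := hG.isCycles.reachable_deleteEdges h.ab
        refine (reachable_deleteEdges_of_ne (G := G.deleteEdges {s(a, b)}) (f := f) (a := c) (b := d)
          (fun x y hxy => hf' _ _ hxy.1) this hac hcd).mono h.deleteEdges_le
      have hcd' : G'.Reachable c d := by
        have := hG.isCycles.reachable_deleteEdges h.cd
        refine (reachable_deleteEdges_of_ne (G := G.deleteEdges {s(c, d)}) (f := f) (a := a) (b := b)
          (fun x y hxy => hf' _ _ hxy.1) this hac.symm (hf' _ _ h.ab)).mono ?_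
        rw [SimpleGraph.deleteEdges_deleteEdges, Set.union_comm,
          ← SimpleGraph.deleteEdges_deleteEdges]
        exact h.deleteEdges_le
      rcases h2 with he | he <;> rcases Sym2.eq_iff.1 he with ⟨rfl, rfl⟩ | ⟨rfl, rfl⟩
      exacts [hab', hab'.symm, hcd', hcd'.symm]
    · exact SimpleGraph.Adj.reachable ((h.adj_iff x y).2 (.inl ⟨hxy, not_or.1 h2⟩))
  have hbc : G'.Reachable b c := h.adj_bc.reachable
  have hb : f b = f a := (hf' _ _ h.ab).symm
  have key (w : V) : G'.Reachable w c := by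
    -- `f` takes only two values.
    have : f w = f b ∨ f w = f c := by
      rw [hb]; revert hac; generalize f w = x; generalize f a = y; generalize f c = z
      revert x y z; decide
    rcases this with hw | hw
    · exact (hM _ _ ((hr _ _).2 hw)).trans hbc
    · exact hM _ _ ((hr _ _).2 hw)
  exact fun u v => (key u).trans (key v).symm

end IsQuadExchange

/-- A two-regular graph whose components are the two level sets of `f` consists of two cycles. -/
theorem IsTwoRegular.exists_consistsOfTwoCycles [Finite V] (hG : IsTwoRegular G) {f : V → ZMod 2}
    (hr : ∀ u v, G.Reachable u v ↔ f u = f v) (hab : f a ≠ f b) :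
    ∃ H₁ H₂ : G.Subgraph, ConsistsOfTwoCycles G H₁ H₂ := by
  obtain ⟨p, hp, hpv⟩ := hG.exists_isCycle a
  obtain ⟨q, hq, hqv⟩ := hG.exists_isCycle b
  have hcov (v : V) : v ∈ p.toSubgraph.verts ∨ v ∈ q.toSubgraph.verts := by
    simp only [hpv, hqv, Set.mem_ofPred_eq, hr]
    revert hab; generalize f v = x; generalize f a = y; generalize f b = z
    revert x y z; decide
  refine ⟨p.toSubgraph, q.toSubgraph, ⟨a, p, hp, rfl⟩, ⟨b, q, hq, rfl⟩, ?_, ?_⟩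
  · rw [hpv, hqv, Set.disjoint_left]
    intro v hv hv'
    simp only [Set.mem_ofPred_eq, hr] at hv hv'
    exact hab (hv.symm.trans hv')
  · refine SimpleGraph.Subgraph.ext ?_ ?_
    · ext v
      simpa using hcov v
    · ext u v
      simp only [SimpleGraph.Subgraph.sup_adj, SimpleGraph.Subgraph.top_adj]
      refine ⟨fun h => h.elim (·.adj_sub) (·.adj_sub), fun h => ?_⟩
      exact (hcov u).imp (hG.adj_toSubgraph hp · h) (hG.adj_toSubgraph hq · h)

/-- If `G` consists of two cycles, and `f` is a nonconstant invariant of its components, then the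
two cycles are the two level sets of `f`. -/
theorem ConsistsOfTwoCycles.exists_ne {H₁ H₂ : G.Subgraph} (h : ConsistsOfTwoCycles G H₁ H₂)
    {f : V → ZMod 2} (hf : ∀ u v, G.Adj u v → f u = f v) (hab : f a ≠ f b) :
    ∃ x y, x ≠ y ∧ (∀ v, v ∈ H₁.verts ↔ f v = x) ∧ (∀ v, v ∈ H₂.verts ↔ f v = y) := by
  obtain ⟨⟨v₁, c₁, -, rfl⟩, ⟨v₂, c₂, -, rfl⟩, -, htop⟩ := h
  have hcov (v : V) : v ∈ c₁.support ∨ v ∈ c₂.support := by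
    have : v ∈ (c₁.toSubgraph ⊔ c₂.toSubgraph).verts := by rw [htop]; trivial
    simpa using this
  have h₁ (v : V) (hv : v ∈ c₁.support) : f v = f v₁ := by
    classical exact (eq_of_reachable hf ⟨c₁.takeUntil v hv⟩).symm
  have h₂ (v : V) (hv : v ∈ c₂.support) : f v = f v₂ := by
    classical exact (eq_of_reachable hf ⟨c₂.takeUntil v hv⟩).symm
  have hne : f v₁ ≠ f v₂ := fun he => hab <| by
    have (v : V) : f v = f v₂ := (hcov v).elim (fun hv => (h₁ v hv).trans he) (h₂ v)
    rw [this a, this b]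
  refine ⟨f v₁, f v₂, hne, fun v => ?_, fun v => ?_⟩
  · rw [SimpleGraph.Walk.mem_verts_toSubgraph]
    exact ⟨h₁ v, fun hv => (hcov v).resolve_right fun h => hne (hv.symm.trans (h₂ v h))⟩
  · rw [SimpleGraph.Walk.mem_verts_toSubgraph]
    exact ⟨h₂ v, fun hv => (hcov v).resolve_left fun h => hne ((h₁ v h).symm.trans hv)⟩

end GraphLemmas

/-! ### Hamiltonian cycles of the grid -/

section Hamiltonian

variable {m n : ℕ} {H : SimpleGraph (Fin m × Fin n)}

theorem IsHamCycleOfGrid.isTwoRegular (hH : IsHamCycleOfGrid H) : IsTwoRegular H := by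
  obtain ⟨-, v, p, hp, htop⟩ := hH
  intro w
  have := hp.isCycle.ncard_neighborSet_toSubgraph_eq_two (hp.mem_support w)
  rwa [htop, SimpleGraph.Subgraph.neighborSet_top] at this

theorem IsHamCycleOfGrid.preconnected (hH : IsHamCycleOfGrid H) : H.Preconnected := by
  obtain ⟨-, v, p, hp, -⟩ := hH
  have key (w) : H.Reachable v w := ⟨p.takeUntil w (hp.mem_support w)⟩
  exact fun u w => (key u).symm.trans (key w)

/-- A connected two-regular subgraph of the grid is a Hamiltonian cycle. -/
theorem isHamCycleOfGrid_of_isTwoRegular (hle : H ≤ gridGraph m n) (hH : IsTwoRegular H)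
    (hc : H.Preconnected) (v : Fin m × Fin n) : IsHamCycleOfGrid H := by
  obtain ⟨p, hp, hpv⟩ := hH.exists_isCycle v
  have hcov (w) : w ∈ p.toSubgraph.verts := by rw [hpv]; exact hc w v
  refine ⟨hle, v, p, ?_, ?_⟩
  · rw [SimpleGraph.Walk.isHamiltonianCycle_isCycle_and_isHamiltonian_tail]
    refine ⟨hp, hp.isPath_tail.isHamiltonian_of_mem fun w => ?_⟩
    have := (p.mem_verts_toSubgraph).1 (hcov w)
    rw [SimpleGraph.Walk.support_tail_of_not_nil _ hp.not_nil]
    rw [SimpleGraph.Walk.mem_support_iff] at this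
    rcases this with rfl | h
    · exact SimpleGraph.Walk.end_mem_tail_support hp.not_nil
    · exact h
  · refine SimpleGraph.Subgraph.ext ?_ ?_
    · ext w
      simpa using hcov w
    · ext u w
      exact ⟨fun h => h.adj_sub, hH.adj_toSubgraph hp (hcov u)⟩

end Hamiltonian

/-! ### Boxes and their sides -/

section Boxes

variable {m n : ℕ}

namespace GridBox

theorem south_ne_north (B : GridBox m n) : B.south ≠ B.north := by
  simp [south, north, sw, se, nw, ne]

theorem south_ne_east (B : GridBox m n) : B.south ≠ B.east := by
  simp [south, east, sw, se, ne]

theorem south_ne_west (B : GridBox m n) : B.south ≠ B.west := by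
  simp [south, west, sw, se, nw]

theorem east_ne_north (B : GridBox m n) : B.east ≠ B.north := by
  simp [east, north, se, nw, ne]

theorem east_ne_west (B : GridBox m n) : B.east ≠ B.west := by
  simp [east, west, sw, se, nw, ne]

theorem north_ne_west (B : GridBox m n) : B.north ≠ B.west := by
  simp [north, west, sw, nw, ne]

theorem mem_edges {B : GridBox m n} {e : Sym2 (Fin m × Fin n)} :
    e ∈ B.edges ↔ e = B.south ∨ e = B.east ∨ e = B.north ∨ e = B.west := Iff.rfl

theorem mem_verts {B : GridBox m n} {v : Fin m × Fin n} :
    v ∈ B.verts ↔ v = B.sw ∨ v = B.se ∨ v = B.ne ∨ v = B.nw := Iff.rfl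

/-- The four ways in which two distinct boxes may share a side. -/
theorem shared_side {B C : GridBox m n} {e : Sym2 (Fin m × Fin n)} (hB : e ∈ B.edges)
    (hC : e ∈ C.edges) (hBC : B ≠ C) :
    (e = B.south ∧ C.k = B.k ∧ C.l + 1 = B.l) ∨ (e = B.north ∧ C.k = B.k ∧ C.l = B.l + 1) ∨
    (e = B.west ∧ C.k + 1 = B.k ∧ C.l = B.l) ∨ (e = B.east ∧ C.k = B.k + 1 ∧ C.l = B.l) := by
  rw [Ne, GridBox.ext_iff] at hBC
  rw [mem_edges] at hB hC
  rcases hB with rfl | rfl | rfl | rfl <;> rcases hC with h | h | h | h <;>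
    simp only [south, east, north, west, sw, se, nw, ne, Sym2.eq_iff, Prod.mk.injEq,
      Fin.mk.injEq] at h <;>
    first
      | exact absurd hBC (by omega)
      | exact .inl ⟨rfl, by omega, by omega⟩
      | exact .inr (.inl ⟨rfl, by omega, by omega⟩)
      | exact .inr (.inr (.inl ⟨rfl, by omega, by omega⟩))
      | exact .inr (.inr (.inr ⟨rfl, by omega, by omega⟩))

theorem side_unique {B C : GridBox m n} {e e' : Sym2 (Fin m × Fin n)} (hBC : B ≠ C)
    (hB : e ∈ B.edges) (hC : e ∈ C.edges) (hB' : e' ∈ B.edges) (hC' : e' ∈ C.edges) : e = e' := by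
  have h := shared_side hB hC hBC
  have h' := shared_side hB' hC' hBC
  grind

theorem box_unique {B C D : GridBox m n} {e : Sym2 (Fin m × Fin n)} (hB : e ∈ B.edges)
    (hC : e ∈ C.edges) (hD : e ∈ D.edges) (hBC : B ≠ C) (hBD : B ≠ D) : C = D := by
  have h := shared_side hB hC hBC
  have h' := shared_side hB hD hBD
  have h1 := B.south_ne_north
  have h2 := B.south_ne_east
  have h3 := B.south_ne_west
  have h4 := B.east_ne_north
  have h5 := B.east_ne_west
  have h6 := B.north_ne_west
  rw [GridBox.ext_iff]
  grind

theorem exists_eq_of_mem_edges {B : GridBox m n} {e : Sym2 (Fin m × Fin n)} (he : e ∈ B.edges) :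
    ∃ u ∈ B.verts, ∃ v ∈ B.verts, (gridGraph m n).Adj u v ∧ e = s(u, v) := by
  rw [mem_edges] at he
  rcases he with rfl | rfl | rfl | rfl
  · exact ⟨B.sw, by simp [verts], B.se, by simp [verts],
      by simp [gridGraph, SimpleGraph.boxProd_adj, SimpleGraph.pathGraph_adj, sw, se], rfl⟩
  · exact ⟨B.se, by simp [verts], B.ne, by simp [verts],
      by simp [gridGraph, SimpleGraph.boxProd_adj, SimpleGraph.pathGraph_adj, se, ne], rfl⟩
  · exact ⟨B.nw, by simp [verts], B.ne, by simp [verts],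
      by simp [gridGraph, SimpleGraph.boxProd_adj, SimpleGraph.pathGraph_adj, nw, ne], rfl⟩
  · exact ⟨B.sw, by simp [verts], B.nw, by simp [verts],
      by simp [gridGraph, SimpleGraph.boxProd_adj, SimpleGraph.pathGraph_adj, sw, nw], rfl⟩

theorem edges_subset_gridGraph (B : GridBox m n) : B.edges ⊆ (gridGraph m n).edgeSet := by
  intro e he
  obtain ⟨u, -, v, -, h, rfl⟩ := exists_eq_of_mem_edges he
  exact h

end GridBox

/-! ### Closed box paths and mod 2 potentials -/

/-- A mod 2 cochain on the edges of the grid which sums to zero around each box is a coboundary. -/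
theorem exists_potential (c : Sym2 (Fin m × Fin n) → ZMod 2)
    (hc : ∀ B : GridBox m n, c B.south + c B.east + c B.north + c B.west = 0) :
    ∃ f : Fin m × Fin n → ZMod 2, ∀ u v, (gridGraph m n).Adj u v → f u = f v + c s(u, v) := by
  -- The cochain on horizontal and vertical edges, extended by zero to the whole quadrant.
  let h (i j : ℕ) : ZMod 2 := if hij : i + 1 < m ∧ j < n then
    c s((⟨i, by omega⟩, ⟨j, hij.2⟩), (⟨i + 1, hij.1⟩, ⟨j, hij.2⟩)) else 0
  let t (i j : ℕ) : ZMod 2 := if hij : i < m ∧ j + 1 < n then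
    c s((⟨i, hij.1⟩, ⟨j, by omega⟩), (⟨i, hij.1⟩, ⟨j + 1, hij.2⟩)) else 0
  have two : (2 : ZMod 2) = 0 := rfl
  let F (i j : ℕ) : ZMod 2 := ∑ x ∈ Finset.range i, h x 0 + ∑ y ∈ Finset.range j, t i y
  have hv (i j : ℕ) : F i (j + 1) = F i j + t i j := by
    simp only [F, Finset.sum_range_succ]; ring
  have hh (i j : ℕ) (hi : i + 1 < m) (hj : j < n) : F (i + 1) j = F i j + h i j := by
    induction j with
    | zero => simp [F, Finset.sum_range_succ]
    | succ j ih =>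
      have hbox : h i j + t (i + 1) j + h i (j + 1) + t i j = 0 := by
        have := hc ⟨i, j, hi, hj⟩
        simp only [h, t]
        rw [dif_pos ⟨hi, by omega⟩, dif_pos ⟨hi, hj⟩, dif_pos ⟨hi, hj⟩, dif_pos ⟨by omega, hj⟩]
        exact this
      rw [hv, hv, ih (by omega)]
      linear_combination hbox - (h i (j + 1) + t i j) * two
  refine ⟨fun v => F v.1 v.2, ?_⟩
  have step (u v : Fin m × Fin n) (huv : (u.1.val + 1 = v.1.val ∧ u.2 = v.2) ∨
      (u.2.val + 1 = v.2.val ∧ u.1 = v.1)) : F v.1 v.2 = F u.1 u.2 + c s(u, v) := by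
    obtain ⟨⟨i, hi⟩, ⟨j, hj⟩⟩ := u
    obtain ⟨⟨i', hi'⟩, ⟨j', hj'⟩⟩ := v
    simp only [Fin.mk.injEq] at huv
    rcases huv with ⟨rfl, rfl⟩ | ⟨rfl, rfl⟩
    · have : h i j = _ := dif_pos ⟨hi', hj⟩
      rw [← this]
      exact hh i j hi' hj
    · have : t i j = _ := dif_pos ⟨hi, hj'⟩
      rw [← this]
      exact hv i j
  intro u v huv
  simp only [gridGraph, SimpleGraph.boxProd_adj, SimpleGraph.pathGraph_adj] at huv
  have key : ((u.1.val + 1 = v.1.val ∧ u.2 = v.2) ∨ (u.2.val + 1 = v.2.val ∧ u.1 = v.1)) ∨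
      ((v.1.val + 1 = u.1.val ∧ v.2 = u.2) ∨ (v.2.val + 1 = u.2.val ∧ v.1 = u.1)) := by
    rcases huv with ⟨h | h, h'⟩ | ⟨h | h, h'⟩ <;> simp [h, h']
  rcases key with h | h
  · linear_combination - step u v h - c s(u, v) * two
  · rw [Sym2.eq_swap]
    exact step v u h

variable {K : SimpleGraph (Fin m × Fin n)}

/-- The edges of the grid crossed by a family `S` of pairs of adjacent boxes. -/
def crossedEdges (S : (hBoxGraph K).Subgraph) : Set (Sym2 (Fin m × Fin n)) :=
  {e | ∃ C D, S.Adj C D ∧ e ∈ C.edges ∧ e ∈ D.edges}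

theorem notMem_edgeSet_of_mem_crossedEdges {S : (hBoxGraph K).Subgraph} {e : Sym2 (Fin m × Fin n)}
    (he : e ∈ crossedEdges S) : e ∉ K.edgeSet := by
  obtain ⟨C, D, hCD, hC, hD⟩ := he
  intro heK
  have := hCD.adj_sub.2
  exact (this ▸ ⟨⟨hC, hD⟩, heK⟩ : e ∈ (∅ : Set _))

theorem exists_adj_of_mem_crossedEdges {S : (hBoxGraph K).Subgraph} {e : Sym2 (Fin m × Fin n)}
    (he : e ∈ crossedEdges S) {B : GridBox m n} (hB : e ∈ B.edges) :
    ∃ D, S.Adj B D ∧ e ∈ D.edges := by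
  obtain ⟨C, D, hCD, hC, hD⟩ := he
  by_cases hBC : B = C
  · exact ⟨D, hBC ▸ hCD, hD⟩
  by_cases hBD : B = D
  · exact ⟨C, hBD ▸ hCD.symm, hC⟩
  exact absurd (GridBox.box_unique hB hC hD hBC hBD) hCD.ne

/-- Each neighbour of a box `B` in `S` accounts for exactly one crossed side of `B`. -/
theorem ncard_crossedEdges (S : (hBoxGraph K).Subgraph) (B : GridBox m n) :
    (B.edges ∩ crossedEdges S).ncard = (S.neighborSet B).ncard := by
  symm
  have hne (D : GridBox m n) (hD : D ∈ S.neighborSet B) : (B.edges ∩ D.edges).Nonempty :=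
    hD.adj_sub.1.2
  refine Set.ncard_congr (fun D hD => (hne D hD).some) (fun D hD => ?_) (fun D D' hD hD' h => ?_)
    (fun e he => ?_)
  · have := (hne D hD).some_mem
    exact ⟨this.1, B, D, hD, this⟩
  · have h1 := (hne D hD).some_mem
    have h2 := (hne D' hD').some_mem
    replace h : (hne D hD).some = (hne D' hD').some := h
    rw [← h] at h2
    exact GridBox.box_unique h1.1 h1.2 h2.2 hD.ne hD'.ne
  · obtain ⟨D, hD, heD⟩ := exists_adj_of_mem_crossedEdges he.2 he.1
    have := (hne D hD).some_mem
    exact ⟨D, hD, GridBox.side_unique hD.ne this.1 this.2 he.1 heD⟩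

open Classical in
theorem sum_indicator_sides (S : Set (Sym2 (Fin m × Fin n))) (B : GridBox m n) :
    S.indicator (1 : Sym2 (Fin m × Fin n) → ZMod 2) B.south + S.indicator 1 B.east +
      S.indicator 1 B.north + S.indicator 1 B.west = ((B.edges ∩ S).ncard : ZMod 2) := by
  have h1 := B.south_ne_north
  have h2 := B.south_ne_east
  have h3 := B.south_ne_west
  have h4 := B.east_ne_north
  have h5 := B.east_ne_west
  have h6 := B.north_ne_west
  have : B.edges ∩ S =
      (({B.south, B.east, B.north, B.west} : Finset _).filter (· ∈ S) : Set _) := by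
    ext e
    simp [GridBox.mem_edges]
  rw [this, Set.ncard_coe_finset, Finset.card_filter, Nat.cast_sum, Finset.sum_insert (by simp [*]),
    Finset.sum_insert (by simp [*]), Finset.sum_insert (by simp [*]), Finset.sum_singleton]
  simp only [Set.indicator_apply, Pi.one_apply, Nat.cast_ite, Nat.cast_one, Nat.cast_zero]
  ring

/-- The mod 2 Jordan curve theorem for a closed `K`-path `Q` of boxes: the vertices of the grid are
divided into two sides of `Q` so that no edge of `K` joins the two sides, and the boxes of `Q` are
exactly those with vertices on both sides. -/
theorem exists_two_sides (hK : K ≤ gridGraph m n) {X : GridBox m n} {Q : (hBoxGraph K).Walk X X}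
    (hQ : Q.IsCycle) : ∃ f : Fin m × Fin n → ZMod 2, (∀ u v, K.Adj u v → f u = f v) ∧
      ∀ Z : GridBox m n, Z ∈ Q.support ↔ ∃ u ∈ Z.verts, ∃ v ∈ Z.verts, f u ≠ f v := by
  classical
  set S := Q.toSubgraph with hS
  obtain ⟨f, hf⟩ := exists_potential ((crossedEdges S).indicator 1) fun B => by
    rw [sum_indicator_sides, ncard_crossedEdges]
    by_cases hB : B ∈ Q.support
    · rw [hQ.ncard_neighborSet_toSubgraph_eq_two hB]
      rfl
    · have : S.neighborSet B = ∅ := by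
        refine Set.eq_empty_of_forall_notMem fun C hC => hB ?_
        exact (Q.mem_verts_toSubgraph).1 (S.edge_vert hC)
      simp [this]
  have hcross {u v : Fin m × Fin n} (huv : (gridGraph m n).Adj u v) (h : s(u, v) ∉ crossedEdges S) :
      f u = f v := by
    rw [hf u v huv, Set.indicator_of_notMem h, add_zero]
  refine ⟨f, fun u v huv => hcross (hK huv) fun h => notMem_edgeSet_of_mem_crossedEdges h huv,
    fun Z => ⟨fun hZ => ?_, ?_⟩⟩
  · have h2 := hQ.ncard_neighborSet_toSubgraph_eq_two hZ
    rw [← hS, ← ncard_crossedEdges] at h2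
    obtain ⟨e, heZ, heS⟩ := Set.nonempty_of_ncard_ne_zero (by rw [h2]; simp)
    obtain ⟨u, hu, v, hv, huv, rfl⟩ := GridBox.exists_eq_of_mem_edges heZ
    refine ⟨u, hu, v, hv, ?_⟩
    rw [hf u v huv, Set.indicator_of_mem heS]
    simp
  · contrapose!
    intro hZ
    have hside {u v : Fin m × Fin n} (he : s(u, v) ∈ Z.edges) : f u = f v := by
      refine hcross (Z.edges_subset_gridGraph he) fun h => hZ ?_
      obtain ⟨D, hD, -⟩ := exists_adj_of_mem_crossedEdges h he
      exact (Q.mem_verts_toSubgraph).1 (S.edge_vert hD)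
    have h1 : f Z.sw = f Z.se := hside (by simp [GridBox.edges, GridBox.south])
    have h2 : f Z.se = f Z.ne := hside (by simp [GridBox.edges, GridBox.east])
    have h3 : f Z.nw = f Z.ne := hside (by simp [GridBox.edges, GridBox.north])
    intro u hu v hv
    rw [GridBox.mem_verts] at hu hv
    rcases hu with rfl | rfl | rfl | rfl <;> rcases hv with rfl | rfl | rfl | rfl <;>
      simp [h1, h2, h3]

end Boxes

/-! ### Switch moves -/

section Switching

variable {m n : ℕ} {H : SimpleGraph (Fin m × Fin n)}

theorem edgeSet_switchMove (H : SimpleGraph (Fin m × Fin n)) (B : GridBox m n) :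
    (switchMove H B).edgeSet = (H.edgeSet \ B.edges) ∪ (B.edges \ H.edgeSet) := by
  rw [switchMove, SimpleGraph.edgeSet_fromEdgeSet, sdiff_eq_left, Set.disjoint_left]
  rintro e (he | he) hd
  · exact H.not_isDiag_of_mem_edgeSet he.1 hd
  · exact (gridGraph m n).not_isDiag_of_mem_edgeSet (B.edges_subset_gridGraph he.1) hd

theorem mem_edgeSet_switchMove {B : GridBox m n}
    {e : Sym2 (Fin m × Fin n)} :
    e ∈ (switchMove H B).edgeSet ↔ e ∈ H.edgeSet ∧ e ∉ B.edges ∨ e ∈ B.edges ∧ e ∉ H.edgeSet := by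
  rw [edgeSet_switchMove]; rfl

theorem switchMove_le (hH : H ≤ gridGraph m n) (B : GridBox m n) :
    switchMove H B ≤ gridGraph m n := by
  rw [← SimpleGraph.edgeSet_subset_edgeSet, edgeSet_switchMove]
  rintro e (he | he)
  · exact SimpleGraph.edgeSet_subset_edgeSet.2 hH he.1
  · exact B.edges_subset_gridGraph he.1

theorem switchMove_comm (H : SimpleGraph (Fin m × Fin n)) (B C : GridBox m n) :
    switchMove (switchMove H B) C = switchMove (switchMove H C) B := by
  apply SimpleGraph.edgeSet_injective
  ext e
  simp only [mem_edgeSet_switchMove]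
  grind

/-- Switching a box which shares no side with `B` does not affect the switchability of `B`. -/
theorem isSwitchable_switchMove {B C : GridBox m n}
    (hBC : Disjoint B.edges C.edges) (hB : IsSwitchable H B) :
    IsSwitchable (switchMove H C) B := by
  have key {e} (he : e ∈ B.edges) : e ∈ (switchMove H C).edgeSet ↔ e ∈ H.edgeSet := by
    rw [mem_edgeSet_switchMove]
    have := Set.disjoint_left.1 hBC he
    tauto
  unfold IsSwitchable
  rwa [key (by simp [GridBox.edges]), key (by simp [GridBox.edges]), key (by simp [GridBox.edges]),
    key (by simp [GridBox.edges])]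

/-- Switching a switchable box exchanges its two opposite sides in `H` for its other two sides. -/
theorem IsSwitchable.exists_isQuadExchange {B : GridBox m n} (hB : IsSwitchable H B) :
    ∃ a b c d, IsQuadExchange H (switchMove H B) a b c d ∧ B.verts = {a, b, c, d} := by
  have hadj (u v) : (switchMove H B).Adj u v ↔
      H.Adj u v ∧ s(u, v) ∉ B.edges ∨ s(u, v) ∈ B.edges ∧ ¬ H.Adj u v :=
    mem_edgeSet_switchMove (e := s(u, v))
  rcases hB with ⟨hs, hn, he, hw⟩ | ⟨he, hw, hs, hn⟩
  · refine ⟨B.sw, B.se, B.ne, B.nw, ⟨?_, ?_, ?_, ?_, hs, SimpleGraph.Adj.symm hn, he, hw, ?_⟩, rfl⟩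
    · simp [GridBox.sw, GridBox.ne]
    · simp [GridBox.se, GridBox.nw]
    · simp [GridBox.se, GridBox.ne]
    · simp [GridBox.sw, GridBox.nw]
    · intro u v
      rw [hadj, GridBox.mem_edges, Sym2.eq_swap (a := B.ne)]
      change _ ↔ (_ ∧ s(u, v) ≠ B.south ∧ s(u, v) ≠ B.north) ∨ s(u, v) = B.east ∨ s(u, v) = B.west
      change s(u, v) ∈ H.edgeSet ∧ _ ∨ _ ∧ s(u, v) ∉ H.edgeSet ↔ (s(u, v) ∈ H.edgeSet ∧ _) ∨ _
      grind
  · refine ⟨B.se, B.ne, B.nw, B.sw, ⟨?_, ?_, ?_, ?_, he, SimpleGraph.Adj.symm hw,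
      fun h => hn h.symm, fun h => hs h.symm, ?_⟩, ?_⟩
    · simp [GridBox.se, GridBox.nw]
    · simp [GridBox.sw, GridBox.ne]
    · simp [GridBox.nw, GridBox.ne]
    · simp [GridBox.sw, GridBox.se]
    · intro u v
      rw [hadj, GridBox.mem_edges, Sym2.eq_swap (a := B.nw), Sym2.eq_swap (a := B.ne),
        Sym2.eq_swap (a := B.se) (b := B.sw)]
      change _ ↔ (_ ∧ s(u, v) ≠ B.east ∧ s(u, v) ≠ B.west) ∨ s(u, v) = B.north ∨ s(u, v) = B.south
      change s(u, v) ∈ H.edgeSet ∧ _ ∨ _ ∧ s(u, v) ∉ H.edgeSet ↔ (s(u, v) ∈ H.edgeSet ∧ _) ∨ _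
      grind
    · ext v
      simp only [GridBox.mem_verts, Set.mem_insert_iff, Set.mem_singleton_iff]
      tauto

/-- If `f` is constant along the edges of `G'`, it takes two values on the quadrilateral `abcd` only
if it separates `a` from `b`. -/
theorem IsQuadExchange.ne_of_ne {V : Type*} {G G' : SimpleGraph V} {a b c d : V} {f : V → ZMod 2}
    (h : IsQuadExchange G G' a b c d) (hf : ∀ u v, G'.Adj u v → f u = f v)
    (hne : ∃ u ∈ ({a, b, c, d} : Set V), ∃ v ∈ ({a, b, c, d} : Set V), f u ≠ f v) : f a ≠ f b := by
  have h1 := hf _ _ h.adj_bc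
  have h2 := hf _ _ h.adj_ad
  rintro hab
  obtain ⟨u, hu, v, hv, huv⟩ := hne
  simp only [Set.mem_insert_iff, Set.mem_singleton_iff] at hu hv
  grind

end Switching

/-! ### The looping path of a switchable box -/

section LoopingPath

variable {m n : ℕ} {H : SimpleGraph (Fin m × Fin n)} {W X Y : GridBox m n}

theorem exists_side_of_not_isHNeighbour (h : W.Adjacent X) (h' : ¬ IsHNeighbour H W X) :
    ∃ e ∈ H.edgeSet, e ∈ W.edges ∧ e ∈ X.edges := by
  by_contra! hne
  refine h' ⟨h, Set.eq_empty_of_forall_notMem ?_⟩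
  rintro e ⟨⟨h1, h2⟩, h3⟩
  exact hne e h3 h1 h2

/-- Two boxes which share an edge of a Hamiltonian cycle are on different sides of it. -/
theorem IsHamCycleOfGrid.not_reachable (hH : IsHamCycleOfGrid H) (h : W.Adjacent X)
    (h' : ¬ IsHNeighbour H W X) : ¬ (hBoxGraph H).Reachable X W := by
  classical
  -- Otherwise a closed path of boxes crosses `H` only in the common side of `W` and `X`, which is
  -- then a bridge of `H`.
  rintro ⟨p⟩
  obtain ⟨e, heH, heW, heX⟩ := exists_side_of_not_isHNeighbour h h'
  set K := H.deleteEdges {e} with hKdef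
  have hKH : K ≤ H := H.deleteEdges_le _
  have hle : hBoxGraph H ≤ hBoxGraph K := fun B C hBC => ⟨hBC.1, Set.eq_empty_of_subset_empty <| by
    rw [← hBC.2]
    exact Set.inter_subset_inter_right _ (SimpleGraph.edgeSet_subset_edgeSet.2 hKH)⟩
  have hWX : (hBoxGraph K).Adj W X := by
    refine ⟨h, Set.eq_empty_of_forall_notMem ?_⟩
    rintro e' ⟨⟨h1, h2⟩, h3⟩
    rw [GridBox.side_unique h.1 h1 h2 heW heX, hKdef, SimpleGraph.edgeSet_deleteEdges] at h3
    exact h3.2 rfl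
  have hQ : (SimpleGraph.Walk.cons hWX (p.toPath.1.mapLe hle)).IsCycle := by
    rw [SimpleGraph.Walk.cons_isCycle_iff]
    refine ⟨p.toPath.2.mapLe hle, fun hmem => h' ?_⟩
    rw [SimpleGraph.Walk.edges_mapLe_eq_edges] at hmem
    exact p.toPath.1.adj_of_mem_edges hmem
  obtain ⟨f, hf, hfQ⟩ := exists_two_sides (hKH.trans hH.1) hQ
  obtain ⟨u, -, v, -, huv⟩ := (hfQ W).1 (SimpleGraph.Walk.start_mem_support _)
  refine huv (eq_of_reachable hf ?_)
  induction e with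
  | h a b => exact hH.isTwoRegular.reachable_deleteEdges (hH.preconnected u v) heH

theorem IsLoopingPath.notMem_support (hH : IsHamCycleOfGrid H) {P : (hBoxGraph H).Walk X Y}
    (hP : IsLoopingPath H W P) : W ∉ P.support := fun h => by
  classical
  exact hH.not_reachable hP.2.1.1 hP.2.1.2 ⟨P.takeUntil W h⟩

/-- A box of the looping path of `W` which shares a side with `W` is an end-box. -/
theorem IsLoopingPath.disjoint_edges (hH : IsHamCycleOfGrid H) (hW : IsSwitchable H W)
    {P : (hBoxGraph H).Walk X Y} (hP : IsLoopingPath H W P) {Z : GridBox m n} (hZ : Z ∈ P.support)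
    (hX : Z ≠ X) (hY : Z ≠ Y) : Disjoint W.edges Z.edges := by
  classical
  rw [Set.disjoint_iff_inter_eq_empty]
  by_contra hne
  have hWZ : W ≠ Z := fun h => hP.notMem_support hH (h ▸ hZ)
  have hadj : W.Adjacent Z := ⟨hWZ, Set.nonempty_iff_ne_empty.2 hne⟩
  obtain ⟨hXY, ⟨hXW, hXW'⟩, ⟨hYW, hYW'⟩, -⟩ := hP
  by_cases h : IsHNeighbour H W Z
  · refine hH.not_reachable hXW hXW' (SimpleGraph.Reachable.trans ⟨P.takeUntil Z hZ⟩ ?_)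
    exact SimpleGraph.Adj.reachable (G := hBoxGraph H) (SimpleGraph.Adj.symm (G := hBoxGraph H) h)
  · -- The sides which `W` shares with `X`, `Y`, `Z` lie in `H`, but only two sides of `W` do.
    obtain ⟨x, hx, hx1, hx2⟩ := exists_side_of_not_isHNeighbour hXW hXW'
    obtain ⟨y, hy, hy1, hy2⟩ := exists_side_of_not_isHNeighbour hYW hYW'
    obtain ⟨z, hz, hz1, hz2⟩ := exists_side_of_not_isHNeighbour hadj h
    have hxy : x ≠ y := fun h => hXY (GridBox.box_unique hx1 hx2 (h ▸ hy2) hXW.1 hYW.1)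
    have hzx : z ≠ x := fun h => hX (GridBox.box_unique hz1 hz2 (h ▸ hx2) hWZ hXW.1)
    have hzy : z ≠ y := fun h => hY (GridBox.box_unique hz1 hz2 (h ▸ hy2) hWZ hYW.1)
    rw [GridBox.mem_edges] at hx1 hy1 hz1
    unfold IsSwitchable at hW
    grind

theorem IsLoopingPath.adj_switchMove (hH : IsHamCycleOfGrid H) {P : (hBoxGraph H).Walk X Y}
    (hP : IsLoopingPath H W P) {B C : GridBox m n} (h : s(B, C) ∈ P.edges) :
    (hBoxGraph (switchMove H W)).Adj B C := by
  have hBC : IsHNeighbour H B C := P.adj_of_mem_edges h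
  have hWP := hP.notMem_support hH
  have hWB : W ≠ B := fun e => hWP (e ▸ P.fst_mem_support_of_mem_edges h)
  have hWC : W ≠ C := fun e => hWP (e ▸ P.snd_mem_support_of_mem_edges h)
  refine ⟨hBC.1, Set.eq_empty_of_forall_notMem ?_⟩
  rintro e ⟨⟨heB, heC⟩, he⟩
  rcases mem_edgeSet_switchMove.1 he with he | he
  · exact (hBC.2 ▸ ⟨⟨heB, heC⟩, he.1⟩ : e ∈ (∅ : Set _))
  · exact hBC.1.1 (GridBox.box_unique he.1 heB heC hWB hWC)

theorem adj_switchMove_of_not_isHNeighbour (h : W.Adjacent X)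
    (h' : ¬ IsHNeighbour H W X) : (hBoxGraph (switchMove H W)).Adj W X := by
  obtain ⟨x, hx, hxW, hxX⟩ := exists_side_of_not_isHNeighbour h h'
  refine ⟨h, Set.eq_empty_of_forall_notMem ?_⟩
  rintro e ⟨⟨heW, heX⟩, he⟩
  rw [GridBox.side_unique h.1 heW heX hxW hxX, mem_edgeSet_switchMove] at he
  tauto

/-- Closing up the looping path of `W` through `W` gives a cycle of boxes for the switched graph. -/
theorem IsLoopingPath.exists_isCycle (hH : IsHamCycleOfGrid H) {P : (hBoxGraph H).Walk X Y}
    (hP : IsLoopingPath H W P) : ∃ Q : (hBoxGraph (switchMove H W)).Walk X X,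
      Q.reverse.IsCycle ∧ Q.support = P.support ++ [W, X] := by
  have hWX := adj_switchMove_of_not_isHNeighbour hP.2.1.1 hP.2.1.2
  have hWY := adj_switchMove_of_not_isHNeighbour hP.2.2.1.1 hP.2.2.1.2
  have hWP := hP.notMem_support hH
  have hPe : ∀ e ∈ P.edges, e ∈ (hBoxGraph (switchMove H W)).edgeSet := fun e => by
    induction e with
    | h B C => exact hP.adj_switchMove hH
  let P' := P.transfer _ hPe
  have hP's : P'.support = P.support := P.support_transfer hPe
  have hP'e : P'.edges = P.edges := P.edges_transfer hPe
  refine ⟨(P'.concat hWY.symm).concat hWX, ?_, ?_⟩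
  · rw [SimpleGraph.Walk.reverse_concat, SimpleGraph.Walk.cons_isCycle_iff]
    refine ⟨((hP.2.2.2.transfer hPe).concat (by rwa [← hP's] at hWP) hWY.symm).reverse, ?_⟩
    rw [SimpleGraph.Walk.edges_reverse, List.mem_reverse, SimpleGraph.Walk.edges_concat, hP'e,
      List.concat_eq_append, List.mem_append, List.mem_singleton]
    rintro (h | h)
    · exact hWP (P.snd_mem_support_of_mem_edges h)
    · rcases Sym2.eq_iff.1 h with ⟨h, -⟩ | ⟨h, -⟩
      · exact hP.1 h
      · exact hP.2.1.1.1 h.symm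
  · simp [SimpleGraph.Walk.support_concat, hP's]

theorem IsLoopingPath.isHBoxCycle (hH : IsHamCycleOfGrid H) {P : (hBoxGraph H).Walk X Y}
    (hP : IsLoopingPath H W P) : IsHBoxCycle (switchMove H W) (P.support ++ [W, X]) := by
  obtain ⟨Q, -, hQ⟩ := hP.exists_isCycle hH
  refine ⟨?_, ?_, ?_, ?_⟩
  · have hlen : P.length ≠ 0 := fun h => hP.1 (SimpleGraph.Walk.eq_of_length_eq_zero h)
    simp only [List.length_append, SimpleGraph.Walk.length_support, List.length_cons,
      List.length_nil]
    omega
  · rw [List.head?_append_of_ne_nil _ P.support_ne_nil, List.head?_eq_some_head P.support_ne_nil,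
      P.head_support]
    simp
  · rw [← hQ]
    exact Q.isChain_adj_support
  · have : P.support ++ [W, X] = (P.support ++ [W]) ++ [X] := by simp
    rw [this, List.dropLast_concat, List.nodup_append']
    exact ⟨hP.2.2.2.support_nodup, by simp, by simpa using hP.notMem_support hH⟩

end LoopingPath

/-! ### Switching the box of a looping path -/

/-- Let `P` be the looping `H`-path, with end-boxes `X` and `Y`, of a switchable box `W` of a
Hamiltonian cycle `H` of the `m × n` grid graph. (1) For each switchable box `Z` of `P` other than
the end-boxes, `Z ↦ W` is a valid move. (2) Switching `W` yields a graph `H'` consisting of two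
cycles, `P, W, X` is an `H'`-cycle of boxes, and its boxes are exactly the boxes of the grid
incident on both of the two cycles. -/
theorem proposition3p3 (m n : ℕ) (H : SimpleGraph (Fin m × Fin n)) (hH : IsHamCycleOfGrid H)
    (W : GridBox m n) (hW : IsSwitchable H W) (X Y : GridBox m n)
    (P : (hBoxGraph H).Walk X Y) (hP : IsLoopingPath H W P) :
    (∀ Z ∈ P.support, Z ≠ X → Z ≠ Y → IsSwitchable H Z → IsValidMove H Z W) ∧
    IsHBoxCycle (switchMove H W) (P.support ++ [W, X]) ∧
    (∃ H₁ H₂ : (switchMove H W).Subgraph, ConsistsOfTwoCycles (switchMove H W) H₁ H₂) ∧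
    (∀ H₁ H₂ : (switchMove H W).Subgraph, ConsistsOfTwoCycles (switchMove H W) H₁ H₂ →
      ∀ Z : GridBox m n, Z ∈ P.support ++ [W, X] ↔
        (∃ v ∈ Z.verts, v ∈ H₁.verts) ∧ (∃ v ∈ Z.verts, v ∈ H₂.verts)) := by
  have hle := switchMove_le hH.1 W
  obtain ⟨Q, hQ, hQs⟩ := hP.exists_isCycle hH
  obtain ⟨f, hf, hfQ⟩ := exists_two_sides hle hQ
  simp only [SimpleGraph.Walk.support_reverse, List.mem_reverse, hQs] at hfQ
  obtain ⟨a, b, c, d, hex, hverts⟩ := hW.exists_isQuadExchange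
  have hab : f a ≠ f b := hex.ne_of_ne hf (hverts ▸ (hfQ W).1 (by simp))
  have hreg : IsTwoRegular (switchMove H W) := hex.isTwoRegular hH.isTwoRegular
  have hr (u v) : (switchMove H W).Reachable u v ↔ f u = f v :=
    hex.reachable_iff hH.isTwoRegular hH.preconnected hf hab
  refine ⟨fun Z hZP hZX hZY hZ => ?_, hP.isHBoxCycle hH, hreg.exists_consistsOfTwoCycles hr hab,
    fun H₁ H₂ h Z => ?_⟩
  -- Switching `Z` second, in the two cycles left by `W`, gives the same graph.
  · have hdisj := hP.disjoint_edges hH hW hZP hZX hZY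
    refine ⟨hZ, isSwitchable_switchMove hdisj hW, ?_⟩
    rw [switchMove_comm]
    obtain ⟨a', b', c', d', hex', hverts'⟩ :=
      (isSwitchable_switchMove hdisj.symm hZ).exists_isQuadExchange
    refine isHamCycleOfGrid_of_isTwoRegular (switchMove_le hle Z) (hex'.isTwoRegular hreg)
      (hex'.preconnected hreg hr ?_) a'
    obtain ⟨u, hu, v, hv, huv⟩ := (hfQ Z).1 (by simp [hZP])
    have h1 := hf _ _ hex'.ab
    have h2 := hf _ _ hex'.cd
    simp only [hverts', Set.mem_insert_iff, Set.mem_singleton_iff] at hu hv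
    grind
  · obtain ⟨x, y, hxy, h₁, h₂⟩ := h.exists_ne hf hab
    rw [hfQ Z]
    simp only [h₁, h₂]
    constructor
    · rintro ⟨u, hu, v, hv, huv⟩
      have two_values : ∀ p q r s : ZMod 2, p ≠ q → r ≠ s → p = r ∧ q = s ∨ p = s ∧ q = r := by
        decide
      rcases two_values _ _ _ _ huv hxy with ⟨hu', hv'⟩ | ⟨hu', hv'⟩
      · exact ⟨⟨u, hu, hu'⟩, ⟨v, hv, hv'⟩⟩
      · exact ⟨⟨v, hv, hv'⟩, ⟨u, hu, hu'⟩⟩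
    · rintro ⟨⟨u, hu, rfl⟩, ⟨v, hv, rfl⟩⟩
      exact ⟨u, hu, v, hv, hxy⟩
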